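/- For every integer $q \ge 3$ there exists $c > 0$ such that the following holds. For $n \in \mathbb{N}$ let $[n]_p$ denote the random subset of $[n]=\{1,\dots,n\}$ in which every element is included independently with probability $p$. If $p = p(n) = c\, n^{-1/(q-1)}$ (for all $n$ large enough that this number is at most $1$), then $$\lim_{n\to\infty} \mathbb{P}\bigl([n]_p \text{ has a 2-coloring with no monochromatic } q\text{-term arithmetic progression}\bigr) = 1 ,$$ where a $q$-term arithmetic progression is a set $\{a, a+d, \dots, a+(q-1)d\}$ with $d \ge 1$, and it is monochromatic if it is contained in $[n]_p$ and all its elements receive the same color. -/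

import Mathlib

/-- The law of the `p`-random subset `[n]_p` of `[n] = {1, …, n}`: every element of `[n]` is
selected with probability `p`, independently of all the others. -/
noncomputable def randomSubset (n : ℕ) (p : unitInterval) : MeasureTheory.Measure (Set ℕ) :=
  ProbabilityTheory.setBernoulli (Set.Icc 1 n) p

/-- The coloring `χ` of `S` has a monochromatic `q`-term arithmetic progression
`a, a + d, …, a + (q - 1) d` (with positive common difference `d`) contained in `S`. -/
def HasMonochromaticAP {S : Set ℕ} {r : ℕ} (χ : S → Fin r) (q : ℕ) : Prop :=
  ∃ a d : ℕ, 0 < d ∧ ∃ color : Fin r, ∀ i < q, ∃ h : a + i * d ∈ S, χ ⟨a + i * d, h⟩ = color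

/-- `S` can be colored with `r` colors without a monochromatic `q`-term arithmetic progression. -/
def IsAPFreeColorable (S : Set ℕ) (r q : ℕ) : Prop :=
  ∃ χ : S → Fin r, ¬ HasMonochromaticAP χ q

/-! If a subset of `[n]` is not 2-colorable, a minimal non-2-colorable family `H` of its
progressions has a crossing property: each vertex `v` of each edge `e` is the only common vertex of
`e` and some other edge (`exists_critical_subhypergraph`). Growing a simple path of edges in `H`
greedily therefore either reaches length `L ≈ log₂ n` or stops at a path `W` and a last edge `e`,
meeting `W` in one vertex, such that every edge crossing `e` at another vertex alone hits `W` again.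

Each outcome is ruled out by a first moment bound, where `n p^(q-1)` is a small constant. A path of
`t` edges has `1 + t(q-1)` vertices and at most `n (q² n)^t` choices, so paths of length `L`
contribute at most `p n 2^(-L) ≤ p`. If the path stops earlier, there are two cases. Either the
difference of `e` solves a small linear relation with vertices of the path; then it has only
polylogarithmically many values, and a factor `n` is saved. Or the step is generic. Then two
crossing edges at different vertices of `e` each have exactly `q - 2` new vertices, but not the same
ones, so together at least `q - 1` (`IsGenericStep.le_card_union_sdiff`). Each is determined by a
vertex of `e` and one of `W`, so both cost only polylogarithmically many choices. One crossing edge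
would not do: its `q - 2` new vertices leave no spare factor `p`.

In total the failure probability is `O(p log³ n)`, which tends to `0`. -/

open Finset

/-! ### Containment probabilities -/

/-- A fixed finite set is contained in `[n]_p` with probability at most `p ^ |T|`. -/
theorem randomSubset_superset_le (n : ℕ) (p : unitInterval) (T : Finset ℕ) :
    (randomSubset n p).real {S : Set ℕ | (T : Set ℕ) ⊆ S} ≤ (p : ℝ) ^ #T := by
  have key : randomSubset n p {S : Set ℕ | (T : Set ℕ) ⊆ S}
      ≤ (unitInterval.toNNReal p : ENNReal) ^ #T := by
    have hset : ((fun P : ℕ → Prop => {i | P i}) ⁻¹' {S : Set ℕ | (T : Set ℕ) ⊆ S})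
        = Set.pi (T : Set ℕ) (fun _ => {True}) := by
      ext P
      simp [Set.subset_def, Set.mem_pi]
    rw [randomSubset, ProbabilityTheory.setBernoulli_apply', hset,
      MeasureTheory.Measure.infinitePi_pi _ (by intros; trivial)]
    rw [← Finset.prod_const]
    -- The factor is `p` for `i` in `[n]` and `0` outside, hence an inequality.
    refine Finset.prod_le_prod' fun i _ => ?_
    by_cases hi : i ∈ Set.Icc 1 n
    · simp [hi]
    · simp [hi]
  have := ENNReal.toReal_mono (by simp) key
  simpa [MeasureTheory.measureReal_def] using this

/-- Union bound over a finite family of sets of size at least `k`. -/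
theorem randomSubset_family_le (n : ℕ) (p : unitInterval) (𝒯 : Finset (Finset ℕ)) (k : ℕ)
    (hk : ∀ T ∈ 𝒯, k ≤ #T) :
    (randomSubset n p).real {S : Set ℕ | ∃ T ∈ 𝒯, (T : Set ℕ) ⊆ S} ≤ #𝒯 * (p : ℝ) ^ k := by
  have hset : {S : Set ℕ | ∃ T ∈ 𝒯, (T : Set ℕ) ⊆ S}
      = ⋃ T ∈ 𝒯, {S : Set ℕ | (T : Set ℕ) ⊆ S} := by
    ext S; simp
  have : MeasureTheory.IsProbabilityMeasure (randomSubset n p) := by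
    unfold randomSubset; infer_instance
  rw [hset]
  refine (MeasureTheory.measureReal_biUnion_finset_le _ _).trans ?_
  rw [← nsmul_eq_mul]
  refine Finset.sum_le_card_nsmul _ _ _ fun T hT => ?_
  exact (randomSubset_superset_le n p T).trans
    (pow_le_pow_of_le_one p.2.1 p.2.2 (hk T hT))

/-! ### Critical hypergraphs -/

/-- A finite hypergraph which is not 2-colorable contains a nonempty subhypergraph in which every
edge is met in any prescribed single vertex by another edge. -/
theorem exists_critical_subhypergraph {α : Type*} [DecidableEq α] (E : Finset (Finset α))
    (hE : ∀ e ∈ E, 2 ≤ #e)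
    (hnc : ∀ χ : α → Fin 2, ∃ e ∈ E, ∃ c, ∀ x ∈ e, χ x = c) :
    ∃ H ⊆ E, H.Nonempty ∧ ∀ e ∈ H, ∀ v ∈ e, ∃ f ∈ H, f ∩ e = {v} := by
  obtain ⟨H, hHE, hH⟩ := exists_minimal_le_of_wellFoundedLT
    (fun H : Finset (Finset α) => ∀ χ : α → Fin 2, ∃ e ∈ H, ∃ c, ∀ x ∈ e, χ x = c) E hnc
  refine ⟨H, hHE, ?_, ?_⟩
  · obtain ⟨e, he, -⟩ := hH.prop 0
    exact ⟨e, he⟩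
  · intro e he v hv
    -- By minimality some `χ` leaves no edge other than `e` monochromatic, so `e` itself is.
    have hnot : ¬ ∀ χ : α → Fin 2, ∃ f ∈ H.erase e, ∃ c, ∀ x ∈ f, χ x = c := fun h =>
      notMem_erase e H (hH.le_of_le h (erase_subset e H) he)
    push Not at hnot
    obtain ⟨χ, hχ⟩ := hnot
    have hmono : ∀ x ∈ e, χ x = χ v := by
      obtain ⟨g, hg, c, hc⟩ := hH.prop χ
      by_cases hge : g = e
      · subst hge
        intro x hx
        rw [hc x hx, hc v hv]
      · obtain ⟨x, hx, hxc⟩ := hχ g (mem_erase.2 ⟨hge, hg⟩) c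
        exact absurd (hc x hx) hxc
    -- Flipping `v` must create a new monochromatic edge `f`. It contains `v` and carries the
    -- flipped color, while the rest of `e` keeps the old one, so `f` meets `e` only in `v`.
    obtain ⟨f, hf, c, hc⟩ := hH.prop (Function.update χ v (χ v + 1))
    have hflip : χ v + 1 ≠ χ v := by
      generalize χ v = y
      revert y; decide
    have hfe : f ≠ e := by
      rintro rfl
      obtain ⟨u, hu, huv⟩ := exists_mem_ne (hE f (hHE hf)) v
      have h1 := hc u hu
      have h2 := hc v hv
      rw [Function.update_of_ne huv, hmono u hu] at h1
      rw [Function.update_self] at h2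
      exact hflip (h2.trans h1.symm)
    have hvf : v ∈ f := by
      by_contra hvf
      obtain ⟨x, hx, hxc⟩ := hχ f (mem_erase.2 ⟨hfe, hf⟩) c
      refine hxc ?_
      rw [← hc x hx, Function.update_of_ne]
      rintro rfl
      exact hvf hx
    refine ⟨f, hf, ?_⟩
    ext u
    simp only [mem_inter, mem_singleton]
    refine ⟨fun ⟨huf, hue⟩ => ?_, ?_⟩
    · by_contra huv
      have h1 := hc u huf
      have h2 := hc v hvf
      rw [Function.update_of_ne huv, hmono u hue] at h1
      rw [Function.update_self] at h2
      exact hflip (h2.trans h1.symm)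
    · rintro rfl
      exact ⟨hvf, hv⟩

/-! ### Progressions and generic differences -/

/-- The `q`-term arithmetic progression with first term `a` and difference `d`. -/
def apSet (q a d : ℕ) : Finset ℕ := (range q).image fun j => a + j * d

theorem mem_apSet {q a d x : ℕ} : x ∈ apSet q a d ↔ ∃ j < q, a + j * d = x := by
  simp [apSet]

theorem card_apSet (q a : ℕ) {d : ℕ} (hd : 0 < d) : #(apSet q a d) = q := by
  rw [apSet, card_image_of_injective, card_range]
  intro i j hij
  exact Nat.eq_of_mul_eq_mul_right hd (by simpa using hij)

/-- The difference `d` satisfies no nontrivial linear relation with small coefficients with `v` and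
two elements of `W`. -/
def IsGenericStep (q : ℕ) (W : Finset ℕ) (v d : ℕ) : Prop :=
  ∀ w ∈ W, ∀ w' ∈ W, ∀ A B₀ B₁ B₂ : ℤ, |A| ≤ 4 * q ^ 3 → |B₀| ≤ 4 * q ^ 3 → |B₁| ≤ 4 * q ^ 3 →
    |B₂| ≤ 4 * q ^ 3 → A * d + B₀ * v + B₁ * w + B₂ * w' = 0 → A = 0

/-- All differences that satisfy a nontrivial linear relation with `v` and `W`. -/
noncomputable def specialDifferences (q : ℕ) (W : Finset ℕ) (v : ℕ) : Finset ℕ :=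
  (W ×ˢ W ×ˢ Icc (-(4 * q ^ 3 : ℤ)) (4 * q ^ 3) ×ˢ Icc (-(4 * q ^ 3 : ℤ)) (4 * q ^ 3) ×ˢ
    Icc (-(4 * q ^ 3 : ℤ)) (4 * q ^ 3) ×ˢ Icc (-(4 * q ^ 3 : ℤ)) (4 * q ^ 3)).image
    fun x => ((-(x.2.2.2.1 * v + x.2.2.2.2.1 * x.1 + x.2.2.2.2.2 * x.2.1)) / x.2.2.1).toNat

theorem mem_specialDifferences {q : ℕ} {W : Finset ℕ} {v d : ℕ} (h : ¬ IsGenericStep q W v d) :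
    d ∈ specialDifferences q W v := by
  unfold IsGenericStep at h
  push Not at h
  obtain ⟨w, hw, w', hw', A, B₀, B₁, B₂, hA, hB₀, hB₁, hB₂, h, hA0⟩ := h
  rw [specialDifferences, mem_image]
  refine ⟨(w, w', A, B₀, B₁, B₂), ?_, ?_⟩
  · simp only [mem_product, mem_Icc, ← abs_le]
    exact ⟨hw, hw', hA, hB₀, hB₁, hB₂⟩
  -- Since `A ≠ 0`, the relation determines `d` by exact division. Tuples with `A = 0` only add
  -- spurious values to the image.
  · have : -(B₀ * v + B₁ * w + B₂ * w') = A * d := by linarith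
    simp [this, hA0]

theorem card_specialDifferences_le (q : ℕ) (W : Finset ℕ) (v : ℕ) :
    #(specialDifferences q W v) ≤ #W ^ 2 * (8 * q ^ 3 + 1) ^ 4 := by
  refine card_image_le.trans ?_
  simp only [card_product, Int.card_Icc]
  have : ((4 * q ^ 3 : ℤ) + 1 - -(4 * q ^ 3)).toNat = 8 * q ^ 3 + 1 := by
    have : ((4 * q ^ 3 : ℤ) + 1 - -(4 * q ^ 3)) = ((8 * q ^ 3 + 1 : ℕ) : ℤ) := by
      push_cast; ring
    rw [this, Int.toNat_natCast]
  rw [this]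
  apply le_of_eq
  ring

/-- The `q`-term arithmetic progression whose `j`-th term is `x` and whose `k`-th term is `y`. -/
def apThrough (q x y j k : ℕ) : Finset ℕ :=
  apSet q (((j : ℤ) * y - k * x) / ((j : ℤ) - k)).toNat (((x : ℤ) - y) / ((j : ℤ) - k)).toNat

/-- Both quotients are exact, so integer division and `toNat` lose nothing. Two vertices with their
positions thus encode a progression, with no factor `n` in the count. -/
theorem apThrough_eq {q b g j k : ℕ} (hjk : j ≠ k) :
    apThrough q (b + j * g) (b + k * g) j k = apSet q b g := by
  have h0 : (j : ℤ) - k ≠ 0 := sub_ne_zero.2 (by exact_mod_cast hjk)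
  have h1 : (j : ℤ) * ((b + k * g : ℕ) : ℤ) - k * ((b + j * g : ℕ) : ℤ) = ((j : ℤ) - k) * b := by
    push_cast; ring
  have h2 : ((b + j * g : ℕ) : ℤ) - ((b + k * g : ℕ) : ℤ) = ((j : ℤ) - k) * g := by
    push_cast; ring
  rw [apThrough, h1, h2, Int.mul_ediv_cancel_left _ h0, Int.mul_ediv_cancel_left _ h0]
  simp

theorem abs_natCast_sub_le {q i j : ℕ} (hi : i < q) (hj : j < q) : |(i : ℤ) - j| ≤ q := by
  rw [abs_le]; omega

theorem abs_mul_le_mul {a b A B : ℤ} (ha : |a| ≤ A) (hb : |b| ≤ B) : |a * b| ≤ A * B := by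
  rw [abs_mul]
  exact mul_le_mul ha hb (abs_nonneg _) ((abs_nonneg _).trans ha)

theorem abs_sub_le_add {a b A B : ℤ} (ha : |a| ≤ A) (hb : |b| ≤ B) : |a - b| ≤ A + B :=
  (abs_sub a b).trans (add_le_add ha hb)

/-! ### Progressions closing up a generic step -/

/-- After a generic step, a progression that meets the last edge in a single vertex other than the
entry vertex meets the rest of the path at most once. -/
theorem IsGenericStep.eq_of_mem {q : ℕ} {W : Finset ℕ} {a d s b g j k l m : ℕ} (hq : 3 ≤ q)
    (hgen : IsGenericStep q W (a + s * d) d) (hs : s < q) (hm : m < q) (hms : m ≠ s)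
    (hj : j < q) (hk : k < q) (hl : l < q) (hjk : b + j * g ≠ b + k * g)
    (hjl : b + j * g ≠ b + l * g)
    (hv : b + j * g = a + m * d) (hkW : b + k * g ∈ W) (hlW : b + l * g ∈ W) :
    b + k * g = b + l * g := by
  by_contra hkl
  have hkl' : (k : ℤ) - l ≠ 0 := by
    intro h
    have : k = l := by omega
    exact hkl (by rw [this])
  have hms' : (m : ℤ) - s ≠ 0 := by omega
  have hq2 : (q : ℤ) ≤ 4 * q ^ 3 := by
    have : (1 : ℤ) ≤ q := by omega
    nlinarith [pow_pos (show (0 : ℤ) < q by omega) 3,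
      mul_pos (show (0 : ℤ) < q by omega) (show (0 : ℤ) < q by omega)]
  have hqq : (q : ℤ) * q ≤ 4 * q ^ 3 := by
    have : (1 : ℤ) ≤ q := by omega
    nlinarith [mul_pos (show (0 : ℤ) < q by omega) (show (0 : ℤ) < q by omega)]
  have hv' : (b : ℤ) + j * g = a + m * d := by exact_mod_cast hv
  -- Terms `X_j, X_k, X_l` of one progression satisfy `(k-l) X_j + (l-j) X_k + (j-k) X_l = 0`.
  -- Writing `X_j = (a + s d) + (m - s) d` gives `d` the coefficient `(k-l)(m-s) ≠ 0`.
  refine mul_ne_zero hkl' hms' (hgen _ hkW _ hlW (((k : ℤ) - l) * (m - s)) (k - l) (l - j) (j - k)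
    ?_ ?_ ?_ ?_ ?_)
  · exact (abs_mul_le_mul (abs_natCast_sub_le hk hl) (abs_natCast_sub_le hm hs)).trans hqq
  · exact (abs_natCast_sub_le hk hl).trans hq2
  · exact (abs_natCast_sub_le hl hj).trans hq2
  · exact (abs_natCast_sub_le hj hk).trans hq2
  · push_cast
    linear_combination (-((k : ℤ) - l)) * hv'

/-- Here `j + k + l = 3`, so modulo 3 the consecutive differences `j - k` and `k - l` agree. -/
theorem three_dvd_of_perm {j k l : ℕ} (hj : j < 3) (hk : k < 3) (hl : l < 3) (hjk : j ≠ k)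
    (hjl : j ≠ l) (hkl : k ≠ l) : (k : ℤ) - l = (j - k) + 3 * (k - 1) := by
  omega

/-- Two 3-term progressions closing up a generic step in different vertices have no common third
vertex. -/
theorem IsGenericStep.three_ne {W : Finset ℕ} {a d s b g j k l m b' g' j' k' l' m' : ℕ}
    (hgen : IsGenericStep 3 W (a + s * d) d) (hs : s < 3) (hm : m < 3) (hm' : m' < 3)
    (hmm' : m ≠ m')
    (hj : j < 3) (hk : k < 3) (hl : l < 3) (hjk : j ≠ k) (hjl : j ≠ l) (hkl : k ≠ l)
    (hj' : j' < 3) (hk' : k' < 3) (hl' : l' < 3) (hjk' : j' ≠ k') (hjl' : j' ≠ l') (hkl' : k' ≠ l')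
    (hv : b + j * g = a + m * d) (hv' : b' + j' * g' = a + m' * d)
    (hkW : b + k * g ∈ W) (hkW' : b' + k' * g' ∈ W) : b + l * g ≠ b' + l' * g' := by
  intro hz
  have hz1 : (b : ℤ) + l * g = b' + l' * g' := by exact_mod_cast hz
  have hv1 : (b : ℤ) + j * g = a + m * d := by exact_mod_cast hv
  have hv2 : (b' : ℤ) + j' * g' = a + m' * d := by exact_mod_cast hv'
  have bd : ∀ {x y z w : ℕ}, x < 3 → y < 3 → z < 3 → w < 3 →
      |((x : ℤ) - y) * (z - w)| ≤ 9 := fun hx hy hz hw => by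
    simpa using abs_mul_le_mul (abs_natCast_sub_le hx hy) (abs_natCast_sub_le hz hw)
  -- Eliminating the common third vertex leaves a relation whose `d`-coefficient is
  -- `(j-k)(j'-k')(m-m')` modulo 3. Genericity forces this coefficient to vanish, yet no factor is
  -- divisible by 3.
  have hA := hgen _ hkW _ hkW'
    (((j' : ℤ) - k') * (k - l) * (m - s) - ((j : ℤ) - k) * (k' - l') * (m' - s))
    (((j' : ℤ) - k') * (k - l) - ((j : ℤ) - k) * (k' - l'))
    (((j' : ℤ) - k') * (l - j)) (-(((j : ℤ) - k) * (l' - j'))) ?_ ?_ ?_ ?_ ?_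
  · rw [three_dvd_of_perm hj hk hl hjk hjl hkl, three_dvd_of_perm hj' hk' hl' hjk' hjl' hkl'] at hA
    have h3 : (3 : ℤ) ∣ ((j' : ℤ) - k') * ((j : ℤ) - k) * ((m : ℤ) - m') := by
      refine ⟨((j : ℤ) - k) * (k' - 1) * (m' - s) - ((j' : ℤ) - k') * (k - 1) * (m - s), ?_⟩
      linear_combination hA
    have hp : Prime (3 : ℤ) := Int.prime_three
    rcases hp.dvd_or_dvd h3 with h | h
    · rcases hp.dvd_or_dvd h with h | h <;> omega
    · omega
  · exact (abs_sub_le_add (abs_mul_le_mul (bd hj' hk' hk hl) (abs_natCast_sub_le hm hs))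
      (abs_mul_le_mul (bd hj hk hk' hl') (abs_natCast_sub_le hm' hs))).trans (by norm_num)
  · exact (abs_sub_le_add (bd hj' hk' hk hl) (bd hj hk hk' hl')).trans (by norm_num)
  · exact (bd hj' hk' hl hj).trans (by norm_num)
  · rw [abs_neg]
    exact (bd hj hk hl' hj').trans (by norm_num)
  · push_cast
    linear_combination (-(((j' : ℤ) - k') * (k - l))) * hv1 + (((j : ℤ) - k) * (k' - l')) * hv2
      - ((j' : ℤ) - k') * (j - k) * hz1

/-- Two progressions closing up a generic step in different vertices share at most one further
vertex. -/
theorem IsGenericStep.eq_of_common {q : ℕ} {W : Finset ℕ}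
    {a d s b g j k l₁ l₂ m b' g' j' l₁' l₂' m' : ℕ} (hq : 3 ≤ q)
    (hgen : IsGenericStep q W (a + s * d) d) (hs : s < q) (hm : m < q) (hm' : m' < q)
    (hmm' : m ≠ m') (hj : j < q) (hk : k < q) (hl₁ : l₁ < q) (hl₂ : l₂ < q) (hjk : j ≠ k)
    (hj' : j' < q) (hl₁' : l₁' < q) (hl₂' : l₂' < q)
    (hv : b + j * g = a + m * d) (hv' : b' + j' * g' = a + m' * d)
    (hkW : b + k * g ∈ W) (hkv : b + k * g ≠ a + s * d)
    (hz₁ : b + l₁ * g = b' + l₁' * g') (hz₂ : b + l₂ * g = b' + l₂' * g') : l₁' = l₂' := by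
  by_contra hll
  have hll' : (l₁' : ℤ) - l₂' ≠ 0 := by omega
  have hjk' : (j : ℤ) - k ≠ 0 := by omega
  have hmm : (m' : ℤ) - m ≠ 0 := by omega
  have hz₁z : (b : ℤ) + l₁ * g = b' + l₁' * g' := by exact_mod_cast hz₁
  have hz₂z : (b : ℤ) + l₂ * g = b' + l₂' * g' := by exact_mod_cast hz₂
  have hv1 : (b : ℤ) + j * g = a + m * d := by exact_mod_cast hv
  have hv2 : (b' : ℤ) + j' * g' = a + m' * d := by exact_mod_cast hv'
  -- Let `x, x'` be the vertices on the last edge and `w = b + k g`. The two common vertices make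
  -- `g` and `g'` commensurable, which yields `P (x' - x) = R (x - w)`.
  obtain ⟨P, hP⟩ : ∃ P : ℤ, P = ((j : ℤ) - k) * (l₁' - l₂') := ⟨_, rfl⟩
  obtain ⟨R, hR⟩ : ∃ R : ℤ, R = ((l₁ : ℤ) - l₂) * (j' - l₁') - ((j : ℤ) - l₁) * (l₁' - l₂') :=
    ⟨_, rfl⟩
  have hP0 : P ≠ 0 := hP ▸ mul_ne_zero hjk' hll'
  have hrel : P * (a + m' * d) + (-(P + R)) * (a + m * d) + R * (b + k * g) = 0 := by
    subst hP hR
    linear_combination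
      (-(((j : ℤ) - k) * (l₁' - l₂'))) * hv2
      + (((j : ℤ) - k) * (l₁' - l₂')
        + (((l₁ : ℤ) - l₂) * (j' - l₁') - ((j : ℤ) - l₁) * (l₁' - l₂'))) * hv1
      - (((j : ℤ) - k) * (l₁' - l₂')) * hz₁z - ((j : ℤ) - k) * (j' - l₁') * (hz₁z - hz₂z)
  have bd : ∀ {x y z w : ℕ}, x < q → y < q → z < q → w < q →
      |((x : ℤ) - y) * (z - w)| ≤ q * q := fun hx hy hz hw =>
    abs_mul_le_mul (abs_natCast_sub_le hx hy) (abs_natCast_sub_le hz hw)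
  have hPb : |P| ≤ q * q := hP ▸ bd hj hk hl₁' hl₂'
  have hRb : |R| ≤ q * q + q * q := hR ▸ abs_sub_le_add (bd hl₁ hl₂ hj' hl₁') (bd hj hl₁ hl₁' hl₂')
  have hq2 : 2 * ((q : ℤ) * q) ≤ 4 * q ^ 3 := by
    have : (1 : ℤ) ≤ q := by omega
    nlinarith [mul_pos (show (0 : ℤ) < q by omega) (show (0 : ℤ) < q by omega)]
  -- In terms of `v = a + s d`, the relation has `d`-coefficient `P(m'-m) - R(m-s)`, of size at most
  -- `3 q^3`, and remaining part `R (w - v)`. Both vanish, so `R = 0` as `w ≠ v`, and then `P(m'-m)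
  -- = 0`.
  have hA : P * (m' - m) - R * (m - s) = 0 := by
    refine hgen _ hkW _ hkW (P * (m' - m) - R * (m - s)) (-R) R 0 ?_ ?_ ?_ ?_ ?_
    · refine (abs_sub_le_add (abs_mul_le_mul hPb (abs_natCast_sub_le hm' hm))
        (abs_mul_le_mul hRb (abs_natCast_sub_le hm hs))).trans ?_
      have : (0 : ℤ) ≤ q ^ 3 := by positivity
      nlinarith
    · rw [abs_neg]; linarith
    · linarith
    · rw [abs_zero]; positivity
    · push_cast
      linear_combination hrel
  have hR0 : R = 0 := by
    have h1 : R * (((b + k * g : ℕ) : ℤ) - ((a + s * d : ℕ) : ℤ)) = 0 := by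
      push_cast
      linear_combination hrel - d * hA
    rcases mul_eq_zero.1 h1 with h | h
    · exact h
    · exact absurd (by exact_mod_cast sub_eq_zero.1 h) hkv
  rw [hR0, zero_mul, sub_zero] at hA
  exact mul_ne_zero hP0 hmm hA

/-- A progression closing up a generic step has exactly `q - 2` new vertices. -/
theorem IsGenericStep.inter_eq {q : ℕ} {W f : Finset ℕ} {a d s b g x w : ℕ} (hq : 3 ≤ q)
    (hgen : IsGenericStep q W (a + s * d) d) (hs : s < q)
    (heW : apSet q a d ∩ W = {a + s * d}) (hf : f = apSet q b g)
    (hfe : f ∩ apSet q a d = {x}) (hx : x ≠ a + s * d) (hw : w ∈ f) (hwW : w ∈ W) :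
    x ≠ w ∧ f ∩ (W ∪ apSet q a d) = {x, w} := by
  have hxm : x ∈ f ∩ apSet q a d := by simp [hfe]
  rw [mem_inter] at hxm
  have hxW : x ∉ W := fun h => hx <| by
    have : x ∈ apSet q a d ∩ W := mem_inter.2 ⟨hxm.2, h⟩
    simpa [heW] using this
  refine ⟨fun h => hxW (h ▸ hwW), ?_⟩
  ext y
  simp only [mem_inter, mem_union, mem_insert, mem_singleton]
  constructor
  · rintro ⟨hyf, hyW | hye⟩
    · right
      obtain ⟨hx1, hx2⟩ := hxm
      rw [hf] at hw hyf hx1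
      obtain ⟨j, hj, rfl⟩ := mem_apSet.1 hx1
      obtain ⟨k, hk, rfl⟩ := mem_apSet.1 hw
      obtain ⟨l, hl, rfl⟩ := mem_apSet.1 hyf
      obtain ⟨m, hm, hme⟩ := mem_apSet.1 hx2
      refine (hgen.eq_of_mem hq hs hm ?_ hj hk hl ?_ ?_ hme.symm hwW hyW).symm
      · rintro rfl
        exact hx hme.symm
      · intro h
        exact hxW (h ▸ hwW)
      · intro h
        exact hxW (h ▸ hyW)
    · left
      have : y ∈ f ∩ apSet q a d := mem_inter.2 ⟨hyf, hye⟩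
      simpa [hfe] using this
  · rintro (rfl | rfl)
    · exact ⟨hxm.1, Or.inr hxm.2⟩
    · exact ⟨hw, Or.inl hwW⟩

theorem IsGenericStep.card_sdiff {q : ℕ} {W f : Finset ℕ} {a d s b g x w : ℕ} (hq : 3 ≤ q)
    (hgen : IsGenericStep q W (a + s * d) d) (hs : s < q) (hg : 0 < g)
    (heW : apSet q a d ∩ W = {a + s * d}) (hf : f = apSet q b g)
    (hfe : f ∩ apSet q a d = {x}) (hx : x ≠ a + s * d) (hw : w ∈ f) (hwW : w ∈ W) :
    #(f \ (W ∪ apSet q a d)) = q - 2 := by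
  obtain ⟨hxw, h⟩ := hgen.inter_eq hq hs heW hf hfe hx hw hwW
  have h1 := card_sdiff_add_card_inter f (W ∪ apSet q a d)
  rw [h, card_pair hxw, hf, card_apSet q b hg] at h1
  rw [hf]
  omega

/-- Two progressions closing up a generic step in different vertices have together at least
`q - 1` new vertices. -/
theorem IsGenericStep.le_card_union_sdiff {q : ℕ} {W f f' : Finset ℕ}
    {a d s b g x w b' g' x' w' : ℕ} (hq : 3 ≤ q)
    (hgen : IsGenericStep q W (a + s * d) d) (hs : s < q)
    (heW : apSet q a d ∩ W = {a + s * d})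
    (hg : 0 < g) (hf : f = apSet q b g) (hfe : f ∩ apSet q a d = {x}) (hx : x ≠ a + s * d)
    (hw : w ∈ f) (hwW : w ∈ W)
    (hg' : 0 < g') (hf' : f' = apSet q b' g') (hfe' : f' ∩ apSet q a d = {x'})
    (hx' : x' ≠ a + s * d) (hw' : w' ∈ f') (hwW' : w' ∈ W) (hxx' : x ≠ x') :
    q - 1 ≤ #((f ∪ f') \ (W ∪ apSet q a d)) := by
  have hc := hgen.card_sdiff hq hs hg heW hf hfe hx hw hwW
  have hc' := hgen.card_sdiff hq hs hg' heW hf' hfe' hx' hw' hwW'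
  obtain ⟨hxw, -⟩ := hgen.inter_eq hq hs heW hf hfe hx hw hwW
  obtain ⟨hxw', -⟩ := hgen.inter_eq hq hs heW hf' hfe' hx' hw' hwW'
  have hne : f \ (W ∪ apSet q a d) ≠ f' \ (W ∪ apSet q a d) := by
    intro heq
    have hxm : x ∈ f ∩ apSet q a d := by simp [hfe]
    have hxm' : x' ∈ f' ∩ apSet q a d := by simp [hfe']
    rw [mem_inter] at hxm hxm'
    obtain ⟨j, hj, hjx⟩ := mem_apSet.1 (hf ▸ hxm.1)
    obtain ⟨k, hk, hkw⟩ := mem_apSet.1 (hf ▸ hw)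
    obtain ⟨m, hm, hmx⟩ := mem_apSet.1 hxm.2
    obtain ⟨j', hj', hjx'⟩ := mem_apSet.1 (hf' ▸ hxm'.1)
    obtain ⟨k', hk', hkw'⟩ := mem_apSet.1 (hf' ▸ hw')
    obtain ⟨m', hm', hmx'⟩ := mem_apSet.1 hxm'.2
    have hjk : j ≠ k := fun h => hxw (by rw [← hjx, ← hkw, h])
    have hjk' : j' ≠ k' := fun h => hxw' (by rw [← hjx', ← hkw', h])
    have hmm' : m ≠ m' := fun h => hxx' (by rw [← hmx, ← hmx', h])
    have hwe : w ∉ apSet q a d := fun h => hxw <| by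
      have : w ∈ f ∩ apSet q a d := mem_inter.2 ⟨hw, h⟩
      rw [hfe, mem_singleton] at this
      exact this.symm
    have hwe' : w' ∉ apSet q a d := fun h => hxw' <| by
      have : w' ∈ f' ∩ apSet q a d := mem_inter.2 ⟨hw', h⟩
      rw [hfe', mem_singleton] at this
      exact this.symm
    have hnew : ∀ z ∈ f \ (W ∪ apSet q a d), (∃ l < q, b + l * g = z ∧ j ≠ l ∧ k ≠ l) ∧
        ∃ l < q, b' + l * g' = z ∧ j' ≠ l ∧ k' ≠ l := by
      intro z hz
      have hz' := heq ▸ hz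
      rw [mem_sdiff, mem_union, not_or] at hz hz'
      obtain ⟨l, hl, hlz⟩ := mem_apSet.1 (hf ▸ hz.1)
      obtain ⟨l', hl', hlz'⟩ := mem_apSet.1 (hf' ▸ hz'.1)
      refine ⟨⟨l, hl, hlz, ?_, ?_⟩, ⟨l', hl', hlz', ?_, ?_⟩⟩
      · rintro rfl
        exact hz.2.2 (hlz ▸ hjx ▸ hxm.2)
      · rintro rfl
        exact hz.2.1 (hlz ▸ hkw ▸ hwW)
      · rintro rfl
        exact hz.2.2 (hlz' ▸ hjx' ▸ hxm'.2)
      · rintro rfl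
        exact hz.2.1 (hlz' ▸ hkw' ▸ hwW')
    -- Equal sets of new vertices are excluded in two ways: for `q = 3` there is a single one, and
    -- the argument modulo 3 is needed; for `q ≥ 4` there are two, which already fix a relation.
    rcases hq.eq_or_lt with rfl | hq4
    · obtain ⟨z, hz⟩ : (f \ (W ∪ apSet 3 a d)).Nonempty := card_pos.1 (by omega)
      obtain ⟨⟨l, hl, hlz, hjl, hkl⟩, ⟨l', hl', hlz', hjl', hkl'⟩⟩ := hnew z hz
      exact hgen.three_ne hs hm hm' hmm' hj hk hl hjk hjl hkl hj' hk' hl' hjk' hjl' hkl'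
        (hjx.trans hmx.symm) (hjx'.trans hmx'.symm) (hkw ▸ hwW) (hkw' ▸ hwW') (hlz.trans hlz'.symm)
    · obtain ⟨z₁, hz₁, z₂, hz₂, hzz⟩ := one_lt_card.1
        (show 1 < #(f \ (W ∪ apSet q a d)) by omega)
      obtain ⟨⟨l₁, hl₁, hlz₁, -⟩, ⟨l₁', hl₁', hlz₁', -⟩⟩ := hnew z₁ hz₁
      obtain ⟨⟨l₂, hl₂, hlz₂, -⟩, ⟨l₂', hl₂', hlz₂', -⟩⟩ := hnew z₂ hz₂
      refine hzz ?_
      rw [← hlz₁', ← hlz₂', hgen.eq_of_common hq hs hm hm' hmm' hj hk hl₁ hl₂ hjk hj' hl₁' hl₂'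
        (hjx.trans hmx.symm) (hjx'.trans hmx'.symm) (hkw ▸ hwW) ?_ (hlz₁.trans hlz₁'.symm)
        (hlz₂.trans hlz₂'.symm)]
      rw [hkw]
      rintro rfl
      exact hwe (mem_apSet.2 ⟨s, hs, rfl⟩)
  have hss : f \ (W ∪ apSet q a d) ⊂ (f ∪ f') \ (W ∪ apSet q a d) := by
    rw [union_sdiff_distrib]
    refine Finset.ssubset_iff_subset_ne.2 ⟨subset_union_left, fun h => hne ?_⟩
    refine (eq_of_subset_of_card_le ?_ (by omega)).symm
    rw [h]
    exact subset_union_right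
  have := card_lt_card hss
  omega

/-! ### Counting the sparse structures -/

/-- Vertex sets of simple paths of `t` progressions in `[n]`, with an exit vertex. -/
def pathFamily (q n : ℕ) : ℕ → Finset (Finset ℕ × ℕ)
  | 0 => (Icc 1 n).image fun v => ({v}, v)
  | t + 1 => ((pathFamily q n t ×ˢ Icc 1 n ×ˢ range q ×ˢ range q).image
      fun x => (x.1.1 ∪ apSet q (x.1.2 - x.2.2.1 * x.2.1) x.2.1,
        x.1.2 - x.2.2.1 * x.2.1 + x.2.2.2 * x.2.1)).filter
      fun y => #y.1 = 1 + (t + 1) * (q - 1)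

/-- Each step chooses a difference and the positions of the entry and exit vertices, `q² n`
possibilities. -/
theorem card_pathFamily_le (q n t : ℕ) : #(pathFamily q n t) ≤ n * (q ^ 2 * n) ^ t := by
  induction t with
  | zero => simpa [pathFamily] using (card_image_le (s := Icc 1 n))
  | succ t ih =>
    rw [pathFamily]
    refine (card_filter_le _ _).trans (card_image_le.trans ?_)
    simp only [card_product, card_range, Nat.card_Icc]
    calc #(pathFamily q n t) * ((n + 1 - 1) * (q * q))
        ≤ n * (q ^ 2 * n) ^ t * ((n + 1 - 1) * (q * q)) := Nat.mul_le_mul_right _ ih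
      _ = n * (q ^ 2 * n) ^ (t + 1) := by rw [Nat.add_sub_cancel]; ring

theorem card_of_mem_pathFamily {q n t : ℕ} {x : Finset ℕ × ℕ} (hx : x ∈ pathFamily q n t) :
    #x.1 = 1 + t * (q - 1) := by
  cases t with
  | zero =>
    simp only [pathFamily, mem_image] at hx
    obtain ⟨v, -, rfl⟩ := hx
    simp
  | succ t =>
    rw [pathFamily, mem_filter] at hx
    exact hx.2

theorem card_union_apSet {q a d v : ℕ} {W : Finset ℕ} (hd : 0 < d)
    (h : apSet q a d ∩ W = {v}) : #(W ∪ apSet q a d) + 1 = #W + q := by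
  have := card_union_add_card_inter W (apSet q a d)
  rw [inter_comm, h, card_singleton, card_apSet q a hd] at this
  exact this

/-- The entry vertex is `a + s * d`, so truncated subtraction recovers `a`. Meeting `W` only there
gives exactly `q - 1` new vertices, as the size filter demands. -/
theorem mem_pathFamily_succ {q n t a d s r : ℕ} {W : Finset ℕ} (hq : 0 < q)
    (hW : (W, a + s * d) ∈ pathFamily q n t) (hd : 0 < d) (hdn : d ≤ n) (hs : s < q) (hr : r < q)
    (h : apSet q a d ∩ W = {a + s * d}) :
    (W ∪ apSet q a d, a + r * d) ∈ pathFamily q n (t + 1) := by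
  rw [pathFamily, mem_filter, mem_image]
  refine ⟨⟨((W, a + s * d), d, s, r), ?_, ?_⟩, ?_⟩
  · simp only [mem_product, mem_Icc, mem_range]
    exact ⟨hW, ⟨hd, hdn⟩, hs, hr⟩
  · simp
  · have h1 := card_union_apSet hd h
    have h2 := card_of_mem_pathFamily hW
    simp only at h2 ⊢
    rw [add_mul]
    omega

/-- Vertex sets of paths whose last step is not generic. -/
noncomputable def specialFamily (q n t : ℕ) : Finset (Finset ℕ) :=
  ((pathFamily q n t).biUnion fun x => (specialDifferences q x.1 x.2 ×ˢ range q).image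
    fun y => x.1 ∪ apSet q (x.2 - y.2 * y.1) y.1).filter fun T => 1 + (t + 1) * (q - 1) ≤ #T

/-- Vertex sets of paths whose last edge is joined to the rest by two further progressions. -/
def closedFamily (q n t : ℕ) : Finset (Finset ℕ) :=
  ((pathFamily q n t).biUnion fun x =>
    ((Icc 1 n ×ˢ range q) ×ˢ (range q ×ˢ x.1 ×ˢ range q ×ˢ range q) ×ˢ
      (range q ×ˢ x.1 ×ˢ range q ×ˢ range q)).image
    fun y => x.1 ∪ apSet q (x.2 - y.1.2 * y.1.1) y.1.1 ∪
      (apThrough q (x.2 - y.1.2 * y.1.1 + y.2.1.1 * y.1.1) y.2.1.2.1 y.2.1.2.2.1 y.2.1.2.2.2 ∪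
       apThrough q (x.2 - y.1.2 * y.1.1 + y.2.2.1 * y.1.1) y.2.2.2.1 y.2.2.2.2.1 y.2.2.2.2.2)).filter
  fun T => 1 + (t + 2) * (q - 1) ≤ #T

theorem card_specialFamily_le (q n t : ℕ) : #(specialFamily q n t) ≤
    n * (q ^ 2 * n) ^ t * ((1 + t * (q - 1)) ^ 2 * (8 * q ^ 3 + 1) ^ 4 * q) := by
  refine (card_filter_le _ _).trans (card_biUnion_le.trans ?_)
  refine (sum_le_card_nsmul _ _ _ fun x hx => ?_).trans
    (Nat.mul_le_mul_right _ (card_pathFamily_le q n t))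
  refine card_image_le.trans ?_
  rw [card_product, card_range, ← card_of_mem_pathFamily hx]
  exact Nat.mul_le_mul_right _ (card_specialDifferences_le q x.1 x.2)

/-- Only the last edge costs a factor `n`. Each closing progression costs a vertex of `W` and three
positions. -/
theorem card_closedFamily_le (q n t : ℕ) : #(closedFamily q n t) ≤
    n * (q ^ 2 * n) ^ t * (n * (1 + t * (q - 1)) ^ 2 * q ^ 7) := by
  refine (card_filter_le _ _).trans (card_biUnion_le.trans ?_)
  refine (sum_le_card_nsmul _ _ _ fun x hx => ?_).trans
    (Nat.mul_le_mul_right _ (card_pathFamily_le q n t))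
  refine card_image_le.trans ?_
  simp only [card_product, card_range, Nat.card_Icc]
  rw [card_of_mem_pathFamily hx, Nat.add_sub_cancel]
  apply le_of_eq
  ring

/-! ### Finding a sparse structure -/

theorem exists_lt_and_not_succ {P : ℕ → Prop} {L : ℕ} (h0 : P 0) (hL : ¬ P L) :
    ∃ t < L, P t ∧ ¬ P (t + 1) := by
  by_contra! h
  have : ∀ t ≤ L, P t := by
    intro t
    induction t with
    | zero => exact fun _ => h0
    | succ t ih => exact fun ht => h t ht (ih (by omega))
  exact hL (this L le_rfl)

/-- A critical hypergraph of progressions contains one of the sparse structures. -/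
theorem exists_mem_families {q n : ℕ} (hq : 3 ≤ q) (L : ℕ) {S : Set ℕ} {H : Finset (Finset ℕ)}
    (hSn : S ⊆ Set.Icc 1 n) (hne : H.Nonempty)
    (hH : ∀ e ∈ H, (e : Set ℕ) ⊆ S ∧ ∃ a d, 0 < d ∧ e = apSet q a d)
    (hcrit : ∀ e ∈ H, ∀ v ∈ e, ∃ f ∈ H, f ∩ e = {v}) :
    (∃ T ∈ (pathFamily q n L).image Prod.fst, (T : Set ℕ) ⊆ S) ∨
    ∃ t < L, (∃ T ∈ specialFamily q n t, (T : Set ℕ) ⊆ S) ∨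
      ∃ T ∈ closedFamily q n t, (T : Set ℕ) ⊆ S := by
  by_contra! hcon
  obtain ⟨hlong, hcon⟩ := hcon
  -- Take a path of `t` edges that an edge of `H` can continue, where no path of `t + 1` edges can
  -- be continued. The start is a one-vertex path.
  obtain ⟨t, htL, ⟨W, v, hWv, hWS, e, he, heW⟩, hmax⟩ := exists_lt_and_not_succ (L := L)
    (P := fun t => ∃ W v, (W, v) ∈ pathFamily q n t ∧ (W : Set ℕ) ⊆ S ∧ ∃ e ∈ H, e ∩ W = {v})
    (by
      obtain ⟨e, he⟩ := hne
      obtain ⟨heS, a, d, hd, hed⟩ := hH e he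
      have ha : a ∈ e := hed ▸ mem_apSet.2 ⟨0, by omega, by simp⟩
      have := hSn (heS ha)
      refine ⟨{a}, a, ?_, ?_, e, he, ?_⟩
      · simp only [pathFamily, mem_image, mem_Icc]
        exact ⟨a, this, rfl⟩
      · simpa using heS ha
      · simpa using ha)
    (by
      rintro ⟨W, v, hWv, hWS, -⟩
      exact hlong W (mem_image.2 ⟨_, hWv, rfl⟩) hWS)
  obtain ⟨hspec, hclosed⟩ := hcon t htL
  obtain ⟨heS, a, d, hd, rfl⟩ := hH e he
  have hve : v ∈ apSet q a d ∩ W := by simp [heW]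
  obtain ⟨s, hs, rfl⟩ := mem_apSet.1 (mem_inter.1 hve).1
  have hdn : d ≤ n := by
    have : a + 1 * d ∈ apSet q a d := mem_apSet.2 ⟨1, by omega, rfl⟩
    have := (hSn (heS this)).2
    omega
  have hcard := card_union_apSet hd heW
  have hcW := card_of_mem_pathFamily hWv
  simp only at hcW
  have hWeS : ((W ∪ apSet q a d : Finset ℕ) : Set ℕ) ⊆ S := by
    rw [coe_union]
    exact Set.union_subset hWS heS
  have hgen : IsGenericStep q W (a + s * d) d := by
    by_contra hgen
    refine hspec (W ∪ apSet q a d) ?_ hWeS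
    rw [specialFamily, mem_filter, mem_biUnion]
    refine ⟨⟨_, hWv, mem_image.2 ⟨(d, s), ?_, ?_⟩⟩, ?_⟩
    · simp only [mem_product, mem_range]
      exact ⟨mem_specialDifferences hgen, hs⟩
    · simp
    · rw [add_mul]
      omega
  -- A crossing edge that avoided `W` would continue the longer path `W ∪ e`.
  have hclose : ∀ m < q, m ≠ s → ∃ f ∈ H, f ∩ apSet q a d = {a + m * d} ∧ ∃ w ∈ f, w ∈ W := by
    intro m hm hms
    have hmem : a + m * d ∈ apSet q a d := mem_apSet.2 ⟨m, hm, rfl⟩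
    obtain ⟨f, hf, hfe⟩ := hcrit _ he _ hmem
    refine ⟨f, hf, hfe, ?_⟩
    by_contra! hfW
    refine hmax ⟨W ∪ apSet q a d, a + m * d,
      mem_pathFamily_succ (by omega) hWv hd hdn hs hm heW, hWeS, f, hf, ?_⟩
    rw [inter_union_distrib_left, hfe, disjoint_iff_inter_eq_empty.1 (disjoint_left.2 hfW),
      empty_union]
  obtain ⟨m, hm, m', hm', hmm', hms, hms'⟩ : ∃ m < q, ∃ m' < q, m ≠ m' ∧ m ≠ s ∧ m' ≠ s := by
    rcases Nat.lt_or_ge s 1 with h | h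
    · exact ⟨1, by omega, 2, by omega, by omega, by omega, by omega⟩
    · rcases Nat.lt_or_ge s 2 with h | h
      · exact ⟨0, by omega, 2, by omega, by omega, by omega, by omega⟩
      · exact ⟨0, by omega, 1, by omega, by omega, by omega, by omega⟩
  have hinj : ∀ {i j : ℕ}, i ≠ j → a + i * d ≠ a + j * d := fun hij h =>
    hij (Nat.eq_of_mul_eq_mul_right hd (by omega))
  obtain ⟨f, hf, hfe, w, hwf, hwW⟩ := hclose m hm hms
  obtain ⟨f', hf', hfe', w', hwf', hwW'⟩ := hclose m' hm' hms'
  obtain ⟨hfS, b, g, hg, hfb⟩ := hH f hf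
  obtain ⟨hfS', b', g', hg', hfb'⟩ := hH f' hf'
  have hnew := hgen.le_card_union_sdiff hq hs heW hg hfb hfe (hinj hms) hwf hwW hg' hfb' hfe'
    (hinj hms') hwf' hwW' (hinj hmm')
  have hthrough : ∀ {f : Finset ℕ} {b g m w : ℕ}, m ≠ s → f = apSet q b g →
      f ∩ apSet q a d = {a + m * d} → w ∈ f → w ∈ W →
      ∃ j < q, ∃ k < q, apThrough q (a + m * d) w j k = f := by
    intro f b g m w hms hfb hfe hw hwW
    have hm : a + m * d ∈ f ∩ apSet q a d := by simp [hfe]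
    have hxw := (hgen.inter_eq hq hs heW hfb hfe (hinj hms) hw hwW).1
    obtain ⟨j, hj, hjx⟩ := mem_apSet.1 (hfb ▸ (mem_inter.1 hm).1)
    obtain ⟨k, hk, hkw⟩ := mem_apSet.1 (hfb ▸ hw)
    refine ⟨j, hj, k, hk, ?_⟩
    rw [← hjx, ← hkw, apThrough_eq, hfb]
    rintro rfl
    exact hxw (hjx.symm.trans hkw)
  obtain ⟨j, hj, k, hk, hjk⟩ := hthrough hms hfb hfe hwf hwW
  obtain ⟨j', hj', k', hk', hjk'⟩ := hthrough hms' hfb' hfe' hwf' hwW'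
  refine hclosed (W ∪ apSet q a d ∪ (f ∪ f')) ?_ ?_
  · rw [closedFamily, mem_filter, mem_biUnion]
    refine ⟨⟨_, hWv, mem_image.2 ⟨((d, s), (m, w, j, k), (m', w', j', k')), ?_, ?_⟩⟩, ?_⟩
    · simp only [mem_product, mem_range, mem_Icc]
      exact ⟨⟨⟨hd, hdn⟩, hs⟩, ⟨hm, hwW, hj, hk⟩, ⟨hm', hwW', hj', hk'⟩⟩
    · simp [hjk, hjk']
    · rw [← union_sdiff_self_eq_union, card_union_of_disjoint disjoint_sdiff]
      rw [add_mul]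
      omega
  · rw [coe_union (W ∪ _), coe_union f]
    exact Set.union_subset hWeS (Set.union_subset hfS hfS')

/-- A subset of `[n]` that is not 2-colorable contains one of the sparse structures. -/
theorem exists_mem_families_of_not_colorable {q n : ℕ} (hq : 3 ≤ q) (L : ℕ) {S : Set ℕ}
    (hSn : S ⊆ Set.Icc 1 n) (hS : ¬ IsAPFreeColorable S 2 q) :
    (∃ T ∈ (pathFamily q n L).image Prod.fst, (T : Set ℕ) ⊆ S) ∨
    ∃ t < L, (∃ T ∈ specialFamily q n t, (T : Set ℕ) ⊆ S) ∨
      ∃ T ∈ closedFamily q n t, (T : Set ℕ) ⊆ S := by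
  classical
  let E : Finset (Finset ℕ) := (Icc 1 n).powerset.filter
    fun e => (e : Set ℕ) ⊆ S ∧ ∃ a d, 0 < d ∧ e = apSet q a d
  obtain ⟨H, hHE, hne, hcrit⟩ := exists_critical_subhypergraph E
    (by
      intro e he
      obtain ⟨a, d, hd, rfl⟩ := (mem_filter.1 he).2.2
      rw [card_apSet q a hd]
      omega)
    (by
      intro χ
      have hχ : HasMonochromaticAP (fun x : S => χ x) q := by
        by_contra h
        exact hS ⟨_, h⟩
      obtain ⟨a, d, hd, c, hc⟩ := hχ
      have hsub : ((apSet q a d : Finset ℕ) : Set ℕ) ⊆ S := by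
        intro x hx
        obtain ⟨i, hi, rfl⟩ := mem_apSet.1 hx
        exact (hc i hi).1
      refine ⟨apSet q a d, mem_filter.2 ⟨mem_powerset.2 fun x hx => ?_, hsub, a, d, hd, rfl⟩, c, ?_⟩
      · simpa using hSn (hsub hx)
      · intro x hx
        obtain ⟨i, hi, rfl⟩ := mem_apSet.1 hx
        exact (hc i hi).2)
  exact exists_mem_families hq L hSn hne (fun e he => (mem_filter.1 (hHE he)).2) hcrit

/-! ### The union bound and the limit -/

theorem isProbabilityMeasure_randomSubset (n : ℕ) (p : unitInterval) :
    MeasureTheory.IsProbabilityMeasure (randomSubset n p) := by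
  unfold randomSubset
  infer_instance

/-- Union bound over all sparse structures. -/
theorem randomSubset_not_colorable_le {q n L : ℕ} (hq : 3 ≤ q) (p : unitInterval)
    (hL : n ≤ 2 ^ L) (hp : (q : ℝ) ^ 2 * (n * (p : ℝ) ^ (q - 1)) ≤ 1 / 2) :
    (randomSubset n p).real {S : Set ℕ | ¬ IsAPFreeColorable S 2 q} ≤
      p * (1 + L * ((1 + L * (q - 1 : ℕ)) ^ 2 * ((8 * q ^ 3 + 1) ^ 4 * q + q ^ 7))) := by
  have := isProbabilityMeasure_randomSubset n p
  have hp0 : (0 : ℝ) ≤ p := p.2.1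
  obtain ⟨x, hx⟩ : ∃ x : ℝ, x = n * (p : ℝ) ^ (q - 1) := ⟨_, rfl⟩
  rw [← hx] at hp
  have hx0 : 0 ≤ x := by rw [hx]; positivity
  have hx1 : x ≤ 1 := by
    have : (1 : ℝ) ≤ (q : ℝ) ^ 2 := one_le_pow₀ (by exact_mod_cast (by omega : 1 ≤ q))
    nlinarith
  have hy0 : 0 ≤ (q : ℝ) ^ 2 * x := by positivity
  have hy : ∀ t : ℕ, ((q : ℝ) ^ 2 * x) ^ t ≤ 1 := fun t => pow_le_one₀ hy0 (by linarith)
  -- The first vertex contributes the leading `p`; its `n ≤ 2^L` choices are absorbed by `(q² x)^L ≤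
  -- 2^(-L)`.
  have hlong : (randomSubset n p).real
      {S : Set ℕ | ∃ T ∈ (pathFamily q n L).image Prod.fst, (T : Set ℕ) ⊆ S} ≤ p := by
    refine (randomSubset_family_le n p _ (1 + L * (q - 1)) ?_).trans ?_
    · intro T hT
      obtain ⟨y, hy, rfl⟩ := mem_image.1 hT
      exact (card_of_mem_pathFamily hy).ge
    · have h1 : (#((pathFamily q n L).image Prod.fst) : ℝ) ≤ n * (q ^ 2 * n) ^ L := by
        exact_mod_cast card_image_le.trans (card_pathFamily_le q n L)
      have h2 : (n : ℝ) ≤ 2 ^ L := by exact_mod_cast hL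
      calc (#((pathFamily q n L).image Prod.fst) : ℝ) * (p : ℝ) ^ (1 + L * (q - 1))
          ≤ n * (q ^ 2 * n) ^ L * (p : ℝ) ^ (1 + L * (q - 1)) := by gcongr
        _ = p * (n * ((q : ℝ) ^ 2 * x) ^ L) := by
            rw [hx, pow_add, pow_one, mul_comm L, pow_mul, mul_pow, mul_pow, mul_pow]
            ring
        _ ≤ p * (2 ^ L * (1 / 2) ^ L) := by gcongr
        _ = p := by rw [← mul_pow]; norm_num
  obtain ⟨M, hM⟩ : ∃ M : ℝ, M = (1 + L * (q - 1 : ℕ)) ^ 2 := ⟨_, rfl⟩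
  have hMt : ∀ t < L, (1 + t * (q - 1 : ℕ) : ℝ) ^ 2 ≤ M := by
    intro t ht
    rw [hM]
    have : (t : ℝ) ≤ L := by exact_mod_cast ht.le
    gcongr
  have hspec : ∀ t < L, (randomSubset n p).real
      {S : Set ℕ | ∃ T ∈ specialFamily q n t, (T : Set ℕ) ⊆ S} ≤
        p * (M * ((8 * q ^ 3 + 1) ^ 4 * q)) := by
    intro t ht
    refine (randomSubset_family_le n p _ (1 + (t + 1) * (q - 1))
      fun T hT => (mem_filter.1 hT).2).trans ?_
    have h1 : (#(specialFamily q n t) : ℝ) ≤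
        n * (q ^ 2 * n) ^ t * ((1 + t * (q - 1 : ℕ)) ^ 2 * (8 * q ^ 3 + 1) ^ 4 * q) := by
      exact_mod_cast card_specialFamily_le q n t
    calc (#(specialFamily q n t) : ℝ) * (p : ℝ) ^ (1 + (t + 1) * (q - 1))
        ≤ n * (q ^ 2 * n) ^ t * ((1 + t * (q - 1 : ℕ)) ^ 2 * (8 * q ^ 3 + 1) ^ 4 * q)
            * (p : ℝ) ^ (1 + (t + 1) * (q - 1)) := by gcongr
      _ = p * (x * ((q : ℝ) ^ 2 * x) ^ t *
            ((1 + t * (q - 1 : ℕ) : ℝ) ^ 2 * ((8 * q ^ 3 + 1) ^ 4 * q))) := by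
          rw [hx, pow_add, pow_one, mul_comm (t + 1), pow_mul, mul_pow, mul_pow, mul_pow, pow_succ]
          ring
      _ ≤ p * (1 * 1 * (M * ((8 * q ^ 3 + 1) ^ 4 * q))) := by
          have := hy t
          have := hMt t ht
          gcongr
      _ = _ := by ring
  have hclosed : ∀ t < L, (randomSubset n p).real
      {S : Set ℕ | ∃ T ∈ closedFamily q n t, (T : Set ℕ) ⊆ S} ≤ p * (M * q ^ 7) := by
    intro t ht
    refine (randomSubset_family_le n p _ (1 + (t + 2) * (q - 1))
      fun T hT => (mem_filter.1 hT).2).trans ?_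
    have h1 : (#(closedFamily q n t) : ℝ) ≤
        n * (q ^ 2 * n) ^ t * (n * (1 + t * (q - 1 : ℕ)) ^ 2 * q ^ 7) := by
      exact_mod_cast card_closedFamily_le q n t
    calc (#(closedFamily q n t) : ℝ) * (p : ℝ) ^ (1 + (t + 2) * (q - 1))
        ≤ n * (q ^ 2 * n) ^ t * (n * (1 + t * (q - 1 : ℕ)) ^ 2 * q ^ 7)
            * (p : ℝ) ^ (1 + (t + 2) * (q - 1)) := by gcongr
      _ = p * (x * x * ((q : ℝ) ^ 2 * x) ^ t * ((1 + t * (q - 1 : ℕ) : ℝ) ^ 2 * q ^ 7)) := by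
          rw [hx, pow_add, pow_one, mul_comm (t + 2), pow_mul, mul_pow, mul_pow, mul_pow, pow_add]
          ring
      _ ≤ p * (1 * 1 * 1 * (M * q ^ 7)) := by
          have := hy t
          have := hMt t ht
          gcongr
      _ = _ := by ring
  have hsub : {S : Set ℕ | S ⊆ Set.Icc 1 n ∧ ¬ IsAPFreeColorable S 2 q} ⊆
      {S : Set ℕ | ∃ T ∈ (pathFamily q n L).image Prod.fst, (T : Set ℕ) ⊆ S} ∪
      ⋃ t ∈ range L, ({S : Set ℕ | ∃ T ∈ specialFamily q n t, (T : Set ℕ) ⊆ S} ∪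
        {S : Set ℕ | ∃ T ∈ closedFamily q n t, (T : Set ℕ) ⊆ S}) := by
    rintro S ⟨hSn, hS⟩
    rcases exists_mem_families_of_not_colorable hq L hSn hS with h | ⟨t, ht, h⟩
    · exact Or.inl h
    · refine Or.inr (Set.mem_iUnion₂.2 ⟨t, mem_range.2 ht, ?_⟩)
      exact h
  -- The law lives on all sets of naturals, but the structural result needs `S ⊆ [n]`, which holds
  -- almost surely.
  have hae : (randomSubset n p).real {S : Set ℕ | ¬ IsAPFreeColorable S 2 q} =
      (randomSubset n p).real {S : Set ℕ | S ⊆ Set.Icc 1 n ∧ ¬ IsAPFreeColorable S 2 q} := by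
    refine MeasureTheory.measureReal_congr ?_
    have : ∀ᵐ S ∂(randomSubset n p), S ⊆ Set.Icc 1 n := ProbabilityTheory.setBernoulli_ae_subset
    filter_upwards [this] with S hS
    exact propext ⟨fun h => ⟨hS, h⟩, fun h => h.2⟩
  rw [hae]
  refine (MeasureTheory.measureReal_mono hsub).trans ?_
  refine (MeasureTheory.measureReal_union_le _ _).trans ?_
  have hsum : (randomSubset n p).real
      (⋃ t ∈ range L, ({S : Set ℕ | ∃ T ∈ specialFamily q n t, (T : Set ℕ) ⊆ S} ∪
        {S : Set ℕ | ∃ T ∈ closedFamily q n t, (T : Set ℕ) ⊆ S})) ≤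
      L * (p * (M * ((8 * q ^ 3 + 1) ^ 4 * q)) + p * (M * q ^ 7)) := by
    refine (MeasureTheory.measureReal_biUnion_finset_le _ _).trans ?_
    refine (sum_le_card_nsmul _ _ _ fun t ht => ?_).trans_eq (by rw [card_range, nsmul_eq_mul])
    exact (MeasureTheory.measureReal_union_le _ _).trans
      (add_le_add (hspec t (mem_range.1 ht)) (hclosed t (mem_range.1 ht)))
  refine (add_le_add hlong hsum).trans_eq ?_
  rw [hM]
  ring

theorem natLog_two_add_one_le {n : ℕ} (hn : 3 ≤ n) :
    ((Nat.log 2 n + 1 : ℕ) : ℝ) ≤ 3 * Real.log n := by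
  have h1 : (Nat.log 2 n : ℝ) ≤ Real.logb 2 n := by
    simpa using Real.natLog_le_logb n 2
  have hlog2 : (1 : ℝ) / 2 < Real.log 2 := by
    have := Real.log_two_gt_d9
    linarith
  have hn' : (3 : ℝ) ≤ n := by exact_mod_cast hn
  have hlogn : 1 ≤ Real.log n := by
    rw [Real.le_log_iff_exp_le (by linarith)]
    have := Real.exp_one_lt_d9
    linarith
  have h2 : Real.logb 2 n ≤ 2 * Real.log n := by
    rw [Real.logb, div_le_iff₀ (by linarith)]
    nlinarith
  push_cast
  linarith

theorem mainTheorem5 (q : ℕ) (hq : 3 ≤ q) :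
    ∃ c : ℝ, 0 < c ∧
      ∀ p : ℕ → unitInterval,
        (∀ᶠ n : ℕ in Filter.atTop, (p n : ℝ) = c * (n : ℝ) ^ (-(1 / ((q : ℝ) - 1)))) →
        Filter.Tendsto
          (fun n : ℕ => (randomSubset n (p n)).real {S : Set ℕ | IsAPFreeColorable S 2 q})
          Filter.atTop (nhds 1) := by
  have hq0 : (3 : ℝ) ≤ q := by exact_mod_cast hq
  -- Since `n p^(q-1) = c^(q-1) ≤ c`, this choice gives `q² n p^(q-1) ≤ 1/2`.
  obtain ⟨c, hc⟩ : ∃ c : ℝ, c = 1 / (2 * (q : ℝ) ^ 2) := ⟨_, rfl⟩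
  have hc0 : 0 < c := by rw [hc]; positivity
  have hcq : (q : ℝ) ^ 2 * c = 1 / 2 := by rw [hc]; field_simp
  have hc1 : c ≤ 1 := by nlinarith
  refine ⟨c, hc0, fun p hp => ?_⟩
  obtain ⟨ε, hε⟩ : ∃ ε : ℝ, ε = 1 / ((q : ℝ) - 1) := ⟨_, rfl⟩
  have hε0 : 0 < ε := by rw [hε]; exact one_div_pos.2 (by linarith)
  obtain ⟨C, hC⟩ : ∃ C : ℝ, C = (8 * q ^ 3 + 1) ^ 4 * q + q ^ 7 := ⟨_, rfl⟩
  have hC0 : 0 ≤ C := by rw [hC]; positivity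
  have hbound : ∀ᶠ n : ℕ in Filter.atTop,
      1 - (1 + q ^ 2 * C) * 27 * (Real.log n ^ (3 : ℝ) / (n : ℝ) ^ ε) ≤
        (randomSubset n (p n)).real {S : Set ℕ | IsAPFreeColorable S 2 q} := by
    filter_upwards [hp, Filter.eventually_ge_atTop 3] with n hpn hn
    have := isProbabilityMeasure_randomSubset n (p n)
    have hn0 : (0 : ℝ) < n := by exact_mod_cast (by omega : 0 < n)
    have hpow : (n : ℝ) * (p n : ℝ) ^ (q - 1) = c ^ (q - 1) := by
      rw [hpn, mul_pow, ← Real.rpow_natCast ((n : ℝ) ^ _), ← Real.rpow_mul hn0.le]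
      have : -(1 / ((q : ℝ) - 1)) * ((q - 1 : ℕ) : ℝ) = -1 := by
        rw [Nat.cast_sub (by omega), Nat.cast_one]
        have : (q : ℝ) - 1 ≠ 0 := by linarith
        field_simp
      rw [this, Real.rpow_neg_one]
      field_simp
    obtain ⟨L, hL⟩ : ∃ L : ℕ, L = Nat.log 2 n + 1 := ⟨_, rfl⟩
    have hnL : n ≤ 2 ^ L := by rw [hL]; exact (Nat.lt_pow_succ_log_self (by norm_num) n).le
    have hL3 : (L : ℝ) ≤ 3 * Real.log n := by rw [hL]; exact natLog_two_add_one_le hn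
    have hL1 : (1 : ℝ) ≤ L := by rw [hL]; push_cast; linarith [(Nat.log 2 n).cast_nonneg (α := ℝ)]
    have h1 := randomSubset_not_colorable_le hq (p n) hnL (by
      rw [hpow]
      calc (q : ℝ) ^ 2 * c ^ (q - 1) ≤ q ^ 2 * c := by
            gcongr
            exact pow_le_of_le_one hc0.le hc1 (by omega)
        _ ≤ 1 / 2 := hcq.le)
    rw [← hC] at h1
    have h2 : (1 : ℝ) + L * ((1 + L * (q - 1 : ℕ)) ^ 2 * C) ≤
        (1 + q ^ 2 * C) * 27 * Real.log n ^ 3 := by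
      have h3 : (1 : ℝ) + L * (q - 1 : ℕ) ≤ L * q := by
        rw [Nat.cast_sub (by omega), Nat.cast_one]
        linarith
      calc (1 : ℝ) + L * ((1 + L * (q - 1 : ℕ)) ^ 2 * C)
          ≤ (L : ℝ) ^ 3 + L * ((L * q) ^ 2 * C) := by
            gcongr
            exact one_le_pow₀ hL1
        _ = (1 + q ^ 2 * C) * (L : ℝ) ^ 3 := by ring
        _ ≤ (1 + q ^ 2 * C) * (3 * Real.log n) ^ 3 := by gcongr
        _ = (1 + q ^ 2 * C) * 27 * Real.log n ^ 3 := by ring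
    have h4 : (p n : ℝ) ≤ 1 / (n : ℝ) ^ ε := by
      rw [hpn, ← hε, Real.rpow_neg hn0.le, ← one_div]
      exact mul_le_of_le_one_left (by positivity) hc1
    have h5 : (randomSubset n (p n)).real {S : Set ℕ | ¬ IsAPFreeColorable S 2 q} ≤
        (1 + q ^ 2 * C) * 27 * (Real.log n ^ (3 : ℝ) / (n : ℝ) ^ ε) := by
      refine h1.trans ((mul_le_mul h4 h2 (by positivity) (by positivity)).trans_eq ?_)
      rw [show (3 : ℝ) = ((3 : ℕ) : ℝ) by norm_num, Real.rpow_natCast]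
      ring
    have h6 := MeasureTheory.measureReal_union_le (μ := randomSubset n (p n))
      {S : Set ℕ | IsAPFreeColorable S 2 q} {S : Set ℕ | ¬ IsAPFreeColorable S 2 q}
    have h7 : {S : Set ℕ | IsAPFreeColorable S 2 q} ∪ {S : Set ℕ | ¬ IsAPFreeColorable S 2 q} =
        Set.univ := Set.union_compl_self _
    rw [h7, MeasureTheory.probReal_univ] at h6
    linarith
  refine tendsto_of_tendsto_of_tendsto_of_le_of_le' ?_ tendsto_const_nhds hbound
    (Filter.Eventually.of_forall fun n => ?_)
  · have h := ((isLittleO_log_rpow_rpow_atTop 3 hε0).tendsto_div_nhds_zero.comp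
      tendsto_natCast_atTop_atTop).const_mul ((1 + q ^ 2 * C) * 27)
    simpa using (tendsto_const_nhds (x := (1 : ℝ))).sub h
  · have := isProbabilityMeasure_randomSubset n (p n)
    exact MeasureTheory.measureReal_le_one
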